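/- Let $\mathcal C$ be a regular category (finite limits, coequalizers of kernel pairs, regular epimorphisms stable under pullback). Let $\mathrm{Rel}(\mathcal C)$ be the dagger monoidal category with the objects of $\mathcal C$, subobjects of $A\times B$ as morphisms $A\to B$, composition $S\circ R$ the image in $A\times C$ of the pullback $R\times_B S$, diagonals as identities, tensor product induced by the product of $\mathcal C$, coherence isomorphisms the graphs of those of $\mathcal C$, and $R^\dagger$ the converse relation. A special dagger Frobenius structure on $A$ consists of $\mu\colon A\otimes A\to A$ and $\eta\colon I\to A$ such that $\mu(\eta\otimes 1)=1=\mu(1\otimes\eta)$, $\mu(\mu\otimes 1)=\mu(1\otimes\mu)$, $\mu\mu^\dagger=1$ and $(\mu\otimes 1)(1\otimes\mu^\dagger)=(1\otimes\mu)(\mu^\dagger\otimes 1)$ (up to coherence isomorphisms). An internal groupoid $(C_0,C_1,m,s,t,u,i)$ in $\mathcal C$ consists of morphisms $s,t\colon C_1\to C_0$, $u\colon C_0\to C_1$, $m\colon C_1\times_{C_0}C_1\to C_1$ and $i\colon C_1\to C_1$ satisfying the usual equations, where $C_1\times_{C_0}C_1=\{(a,b)\mid s(a)=t(b)\}$ and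 $m(a,b)=a\circ b$. **Theorem.** Special dagger Frobenius structures in $\mathrm{Rel}(\mathcal C)$ are the same as internal groupoids in $\mathcal C$. More precisely: 1. For every special dagger Frobenius structure $(A,\mu,\eta)$ in $\mathrm{Rel}(\mathcal C)$, with $\eta$ given by the subobject $U\rightarrowtail A$, there is exactly one internal groupoid in $\mathcal C$ with object of objects $U$ and object of morphisms $A$ whose identities $u$ are the inclusion $U\rightarrowtail A$ and whose composition, seen as a relation $A\times A\to A$, is $\mu$. 2. For every internal groupoid $(C_0,C_1,m,s,t,u,i)$ in $\mathcal C$, the subobjects $\mu=\{((a,b),c)\mid s(a)=t(b),\ c=m(a,b)\}\rightarrowtail (C_1\times C_1)\times C_1$ and $\eta=(u\colon C_0\rightarrowtail C_1)$ form a special dagger Frobenius structure on $C_1$ in $\mathrm{Rel}(\mathcal C)$. 3. Two internal groupoids with the same object of morphisms $A$ and objects of objects $C_0$, $C_0'$ give the same Frobenius structure on $A$ if and only if there is an isomorphism $e\colon C_0\cong C_0'$ such that $(e,\mathrm{id}_A)$ is an internal functor. Thus special dagger Frobenius structures on $A$ correspond bijectively to internal groupoids with object of morphisms $A$, up to isomorphism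 over $\mathrm{id}_A$. -/

import Mathlib

open CategoryTheory Limits MonoidalCategory CartesianMonoidalCategory

universe v u

/-! ### Dagger monoidal categories and special dagger Frobenius structures -/

/-- A dagger monoidal category: a monoidal category with an involutive, identity-on-objects
contravariant functor `†` that respects `⊗` and for which the coherence isomorphisms are
unitary. -/
class DaggerMonoidalCategory (D : Type u) [Category.{v} D] [MonoidalCategory D] where
  /-- The dagger of a morphism. -/
  dag {X Y : D} (f : X ⟶ Y) : Y ⟶ X
  dag_dag {X Y : D} (f : X ⟶ Y) : dag (dag f) = f
  dag_id (X : D) : dag (𝟙 X) = 𝟙 X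
  dag_comp {X Y Z : D} (f : X ⟶ Y) (g : Y ⟶ Z) : dag (f ≫ g) = dag g ≫ dag f
  dag_tensor {X Y Z W : D} (f : X ⟶ Y) (g : Z ⟶ W) : dag (f ⊗ₘ g) = dag f ⊗ₘ dag g
  dag_associator (X Y Z : D) : dag (α_ X Y Z).hom = (α_ X Y Z).inv
  dag_leftUnitor (X : D) : dag (λ_ X).hom = (λ_ X).inv
  dag_rightUnitor (X : D) : dag (ρ_ X).hom = (ρ_ X).inv

open DaggerMonoidalCategory in
/-- A special dagger Frobenius structure on an object `A` of a dagger monoidal category. -/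
@[ext]
structure SpecialDaggerFrobenius {D : Type u} [Category.{v} D] [MonoidalCategory D]
    [DaggerMonoidalCategory D] (A : D) where
  /-- The multiplication. -/
  mul : A ⊗ A ⟶ A
  /-- The unit. -/
  one : 𝟙_ D ⟶ A
  one_mul : (λ_ A).inv ≫ (one ▷ A) ≫ mul = 𝟙 A
  mul_one : (ρ_ A).inv ≫ (A ◁ one) ≫ mul = 𝟙 A
  assoc : (mul ▷ A) ≫ mul = (α_ A A A).hom ≫ (A ◁ mul) ≫ mul
  special : dag mul ≫ mul = 𝟙 A
  frobenius : (A ◁ dag mul) ≫ (α_ A A A).inv ≫ (mul ▷ A) =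
    (dag mul ▷ A) ≫ (α_ A A A).hom ≫ (A ◁ mul)

/-! ### Relations in a regular category -/

/-- The objects of the category of relations over `C`: the same as those of `C`. -/
structure RelOver (C : Type u) where
  /-- The underlying object of `C`. -/
  as : C

namespace RelOver

variable {C : Type u} [Category.{v} C]

section Covers

/-- In a regular category, strong epimorphisms (equivalently, regular ones) are stable under
pullback. -/
lemma strongEpi_fst [Regular C] {X Y Z : C} (f : X ⟶ Z) (g : Y ⟶ Z) [StrongEpi g] :
    StrongEpi (pullback.fst f g) := by
  have : IsRegularEpi g := inferInstance
  infer_instance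

lemma strongEpi_snd [Regular C] {X Y Z : C} (f : X ⟶ Z) (g : Y ⟶ Z) [StrongEpi f] :
    StrongEpi (pullback.snd f g) := by
  have : IsRegularEpi f := inferInstance
  infer_instance

/-- Membership in a subobject is a local condition. -/
lemma factors_of_strongEpi {X Y Z : C} (P : Subobject Z) (p : Y ⟶ X) [StrongEpi p] (g : X ⟶ Z)
    (h : P.Factors (p ≫ g)) : P.Factors g := by
  have sq : CommSq (P.factorThru _ h) p P.arrow g := ⟨by simp⟩
  rw [← sq.fac_right]
  exact Subobject.factors_comp_arrow _

/-- Membership in an image, after passing to a cover. -/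
lemma image_factors_iff [Regular C] {X Z W : C} (f : W ⟶ Z) (g : X ⟶ Z) :
    (imageSubobject f).Factors g ↔
      ∃ (Y : C) (p : Y ⟶ X) (_ : StrongEpi p) (q : Y ⟶ W), q ≫ f = p ≫ g := by
  constructor
  · intro h
    refine ⟨pullback ((imageSubobject f).factorThru g h)
      (factorThruImageSubobject f), pullback.fst _ _, ?_, pullback.snd _ _, ?_⟩
    · have : StrongEpi (factorThruImageSubobject f) := by
        unfold factorThruImageSubobject
        exact strongEpi_comp _ _
      exact strongEpi_fst _ _
    · have := pullback.condition (f := (imageSubobject f).factorThru g h)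
        (g := factorThruImageSubobject f)
      have e := imageSubobject_arrow_comp f
      calc _ = pullback.snd _ _ ≫ factorThruImageSubobject f ≫ (imageSubobject f).arrow := by
              rw [e]
        _ = _ := by rw [← reassoc_of% this, Subobject.factorThru_arrow]
  · rintro ⟨Y, p, hp, q, hq⟩
    apply factors_of_strongEpi _ p
    have e : p ≫ g = (q ≫ factorThruImageSubobject f) ≫ (imageSubobject f).arrow := by
      rw [← hq, Category.assoc, imageSubobject_arrow_comp]
    rw [e]
    exact Subobject.factors_comp_arrow _

end Covers

variable [CartesianMonoidalCategory C]

/-- A relation from `A` to `B`: a subobject of `A × B`. -/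
@[ext]
structure Hom (A B : RelOver C) where
  /-- The underlying subobject. -/
  sub : Subobject (A.as ⊗ B.as)

namespace Hom

variable {A B : RelOver C}

/-- `R.Mem a b` says that the pair of generalized elements `(a, b)` belongs to `R`. -/
def Mem (R : Hom A B) {X : C} (a : X ⟶ A.as) (b : X ⟶ B.as) : Prop := R.sub.Factors (lift a b)

lemma ext_mem {R S : Hom A B}
    (h : ∀ (X : C) (a : X ⟶ A.as) (b : X ⟶ B.as), R.Mem a b ↔ S.Mem a b) : R = S := by
  have key : ∀ {X : C} (f : X ⟶ A.as ⊗ B.as), f = lift (f ≫ fst _ _) (f ≫ snd _ _) := by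
    intro X f; simp
  ext1
  apply le_antisymm
  · apply Subobject.le_of_factors
    rw [key R.sub.arrow]
    apply (h _ _ _).1
    unfold Mem
    rw [← key]
    exact Subobject.factors_self _
  · apply Subobject.le_of_factors
    rw [key S.sub.arrow]
    apply (h _ _ _).2
    unfold Mem
    rw [← key]
    exact Subobject.factors_self _

lemma Mem.precomp {R : Hom A B} {X : C} {a : X ⟶ A.as} {b : X ⟶ B.as} (h : R.Mem a b)
    {Y : C} (p : Y ⟶ X) : R.Mem (p ≫ a) (p ≫ b) := by
  unfold Mem
  rw [← comp_lift]
  exact Subobject.factors_of_factors_right _ h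

lemma Mem.descend {R : Hom A B} {X : C} {a : X ⟶ A.as} {b : X ⟶ B.as} {Y : C} (p : Y ⟶ X)
    [StrongEpi p] (h : R.Mem (p ≫ a) (p ≫ b)) : R.Mem a b := by
  unfold Mem at *
  rw [← comp_lift] at h
  exact factors_of_strongEpi _ p _ h

end Hom

instance mono_lift_id {X Y : C} (f : X ⟶ Y) : Mono (lift (𝟙 X) f) :=
  mono_of_mono_fac (lift_fst (𝟙 X) f)

/-- The graph of a morphism of `C`, as a relation. -/
noncomputable def graph {A B : RelOver C} (f : A.as ⟶ B.as) : Hom A B :=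
  ⟨Subobject.mk (lift (𝟙 A.as) f)⟩

lemma mem_graph {A B : RelOver C} (f : A.as ⟶ B.as) {X : C} (a : X ⟶ A.as) (b : X ⟶ B.as) :
    (graph f).Mem a b ↔ a ≫ f = b := by
  unfold Hom.Mem graph
  rw [Subobject.mk_factors_iff]
  constructor
  · rintro ⟨(g : X ⟶ A.as), (hg : g ≫ lift (𝟙 A.as) f = lift a b)⟩
    have h1 := congr($hg ≫ fst _ _)
    have h2 := congr($hg ≫ snd _ _)
    simp only [Category.assoc, lift_fst, lift_snd, Category.comp_id] at h1 h2
    rw [← h1, h2]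
  · rintro rfl
    exact ⟨a, by simp⟩

variable [Regular C]

/-- Composition of relations: the image in `A × C` of the pullback `R ×_B S`. -/
noncomputable def comp {A B E : RelOver C} (R : Hom A B) (S : Hom B E) : Hom A E :=
  ⟨imageSubobject (lift
    (pullback.fst (R.sub.arrow ≫ snd _ _) (S.sub.arrow ≫ fst _ _) ≫ R.sub.arrow ≫ fst _ _)
    (pullback.snd (R.sub.arrow ≫ snd _ _) (S.sub.arrow ≫ fst _ _) ≫ S.sub.arrow ≫ snd _ _))⟩

lemma mem_comp {A B E : RelOver C} (R : Hom A B) (S : Hom B E) {X : C} (a : X ⟶ A.as)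
    (c : X ⟶ E.as) : (comp R S).Mem a c ↔
      ∃ (Y : C) (p : Y ⟶ X) (_ : StrongEpi p) (b : Y ⟶ B.as),
        R.Mem (p ≫ a) b ∧ S.Mem b (p ≫ c) := by
  unfold Hom.Mem comp
  rw [image_factors_iff]
  constructor
  · rintro ⟨Y, p, hp, q, hq⟩
    have h1 := congr($hq ≫ fst _ _)
    have h2 := congr($hq ≫ snd _ _)
    simp only [Category.assoc, lift_fst, lift_snd] at h1 h2
    refine ⟨Y, p, hp, q ≫ pullback.fst _ _ ≫ R.sub.arrow ≫ snd _ _, ?_, ?_⟩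
    · rw [← h1, ← comp_lift, ← comp_lift, ← comp_lift, lift_fst_snd, Category.comp_id,
        ← Category.assoc]
      exact Subobject.factors_comp_arrow _
    · rw [← h2, pullback.condition, ← comp_lift, ← comp_lift, ← comp_lift, lift_fst_snd,
        Category.comp_id, ← Category.assoc]
      exact Subobject.factors_comp_arrow _
  · rintro ⟨Y, p, hp, b, h1, h2⟩
    refine ⟨Y, p, hp, pullback.lift (R.sub.factorThru _ h1) (S.sub.factorThru _ h2) (by simp), ?_⟩
    rw [comp_lift, pullback.lift_fst_assoc, pullback.lift_snd_assoc,
      Subobject.factorThru_arrow_assoc, Subobject.factorThru_arrow_assoc, lift_fst, lift_snd,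
      comp_lift]

/-- The tensor product of relations: `(R ⊗ S)((a, c), (b, d))` iff `R(a, b)` and `S(c, d)`. -/
noncomputable def tensor {A B E F : RelOver C} (R : Hom A B) (S : Hom E F) :
    Hom (⟨A.as ⊗ E.as⟩ : RelOver C) ⟨B.as ⊗ F.as⟩ :=
  ⟨(Subobject.pullback (fst A.as E.as ⊗ₘ fst B.as F.as)).obj R.sub ⊓
    (Subobject.pullback (snd A.as E.as ⊗ₘ snd B.as F.as)).obj S.sub⟩

lemma mem_tensor {A B E F : RelOver C} (R : Hom A B) (S : Hom E F) {X : C}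
    (a : X ⟶ A.as ⊗ E.as) (b : X ⟶ B.as ⊗ F.as) : (tensor R S).Mem a b ↔
      R.Mem (a ≫ fst _ _) (b ≫ fst _ _) ∧ S.Mem (a ≫ snd _ _) (b ≫ snd _ _) := by
  unfold Hom.Mem tensor
  rw [Subobject.inf_factors, pullback_factors_iff, pullback_factors_iff,
    lift_map, lift_map]

/-- The converse of a relation: `R†(b, a)` iff `R(a, b)`. -/
noncomputable def converse {A B : RelOver C} (R : Hom A B) : Hom B A :=
  ⟨(Subobject.pullback (lift (snd B.as A.as) (fst B.as A.as))).obj R.sub⟩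

lemma mem_converse {A B : RelOver C} (R : Hom A B) {X : C} (b : X ⟶ B.as) (a : X ⟶ A.as) :
    (converse R).Mem b a ↔ R.Mem a b := by
  unfold Hom.Mem converse
  rw [pullback_factors_iff, comp_lift, lift_fst, lift_snd]

lemma graph_comp {A B E : RelOver C} (f : A.as ⟶ B.as) (R : Hom B E) {X : C} (a : X ⟶ A.as)
    (c : X ⟶ E.as) : (comp (graph f) R).Mem a c ↔ R.Mem (a ≫ f) c := by
  rw [mem_comp]
  constructor
  · rintro ⟨Y, p, hp, b, h1, h2⟩
    rw [mem_graph] at h1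
    subst h1
    rw [Category.assoc] at h2
    exact Hom.Mem.descend p h2
  · intro h
    exact ⟨X, 𝟙 X, inferInstance, a ≫ f, by rw [mem_graph]; simp, by simpa using h⟩

lemma comp_graph_iso {A B E : RelOver C} (R : Hom A B) (e : B.as ≅ E.as) {X : C} (a : X ⟶ A.as)
    (c : X ⟶ E.as) : (comp R (graph e.hom)).Mem a c ↔ R.Mem a (c ≫ e.inv) := by
  rw [mem_comp]
  constructor
  · rintro ⟨Y, p, hp, b, h1, h2⟩
    rw [mem_graph, ← Iso.eq_comp_inv, Category.assoc] at h2
    subst h2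
    exact Hom.Mem.descend p h1
  · intro h
    exact ⟨X, 𝟙 X, inferInstance, c ≫ e.inv, by simpa using h, by rw [mem_graph]; simp⟩

lemma comp_graph_id {A B : RelOver C} (R : Hom A B) : comp R (graph (𝟙 B.as)) = R :=
  Hom.ext_mem fun X a c => by simpa using comp_graph_iso R (Iso.refl B.as) a c

/-- The category of relations over a regular category. -/
noncomputable instance : Category (RelOver C) where
  Hom := Hom
  id A := graph (𝟙 A.as)
  comp := comp
  id_comp R := Hom.ext_mem fun X a c => by rw [graph_comp, Category.comp_id]
  comp_id R := comp_graph_id R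
  assoc {A B E F} R S T := Hom.ext_mem fun X a d => by
    simp only [mem_comp]
    constructor
    · rintro ⟨Y, p, hp, c, ⟨Z, q, hq, b, h1, h2⟩, h3⟩
      refine ⟨Z, q ≫ p, strongEpi_comp _ _, b, by simpa using h1, Z, 𝟙 Z, inferInstance, q ≫ c,
        by simpa using h2, by simpa using h3.precomp q⟩
    · rintro ⟨Y, p, hp, b, h1, Z, q, hq, c, h2, h3⟩
      refine ⟨Z, q ≫ p, strongEpi_comp _ _, c, ⟨Z, 𝟙 Z, inferInstance, q ≫ b,
        by simpa using h1.precomp q, by simpa using h2⟩, by simpa using h3⟩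

lemma graph_comp_graph {A B E : RelOver C} (f : A.as ⟶ B.as) (g : B.as ⟶ E.as) :
    comp (graph f) (graph g) = graph (A := A) (B := E) (f ≫ g) :=
  Hom.ext_mem fun X a c => by rw [graph_comp, mem_graph, mem_graph, Category.assoc]

lemma tensor_graph {A B E F : RelOver C} (f : A.as ⟶ B.as) (g : E.as ⟶ F.as) :
    tensor (graph f) (graph g) = graph (A := ⟨A.as ⊗ E.as⟩) (B := ⟨B.as ⊗ F.as⟩) (f ⊗ₘ g) :=
  Hom.ext_mem fun X a c => by
    rw [mem_tensor, mem_graph, mem_graph, mem_graph]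
    constructor
    · rintro ⟨h1, h2⟩
      ext
      · simpa using h1
      · simpa using h2
    · rintro rfl
      simp

lemma tensor_comp {A₁ B₁ E₁ A₂ B₂ E₂ : RelOver C} (R₁ : Hom A₁ B₁) (R₂ : Hom A₂ B₂)
    (S₁ : Hom B₁ E₁) (S₂ : Hom B₂ E₂) :
    comp (tensor R₁ R₂) (tensor S₁ S₂) = tensor (comp R₁ S₁) (comp R₂ S₂) :=
  Hom.ext_mem fun X a c => by
    simp only [mem_comp, mem_tensor]
    constructor
    · rintro ⟨Y, p, hp, b, ⟨h1, h2⟩, h3, h4⟩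
      exact ⟨⟨Y, p, hp, b ≫ fst _ _, by simpa using h1, by simpa using h3⟩,
        ⟨Y, p, hp, b ≫ snd _ _, by simpa using h2, by simpa using h4⟩⟩
    · rintro ⟨⟨Y, p, hp, b, h1, h2⟩, Z, q, hq, d, h3, h4⟩
      have := strongEpi_fst p q
      have e := pullback.condition (f := p) (g := q)
      refine ⟨pullback p q, pullback.fst p q ≫ p, strongEpi_comp _ _,
        lift (pullback.fst p q ≫ b) (pullback.snd p q ≫ d), ⟨?_, ?_⟩, ?_, ?_⟩
      · simpa using h1.precomp (pullback.fst p q)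
      · rw [e]; simpa using h3.precomp (pullback.snd p q)
      · simpa using h2.precomp (pullback.fst p q)
      · rw [e]; simpa using h4.precomp (pullback.snd p q)

lemma associator_nat {A₁ A₂ A₃ B₁ B₂ B₃ : RelOver C} (R : Hom A₁ B₁) (S : Hom A₂ B₂)
    (T : Hom A₃ B₃) :
    comp (E := ⟨B₁.as ⊗ B₂.as ⊗ B₃.as⟩) (tensor (tensor R S) T) (graph (α_ _ _ _).hom) =
      comp (graph (B := ⟨A₁.as ⊗ A₂.as ⊗ A₃.as⟩) (α_ A₁.as A₂.as A₃.as).hom)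
        (tensor R (tensor S T)) :=
  Hom.ext_mem fun X a c => by
    rw [comp_graph_iso, graph_comp]
    simp only [mem_tensor]
    simp [and_assoc]

lemma leftUnitor_nat {A B : RelOver C} (R : Hom A B) :
    comp (tensor (graph (A := ⟨𝟙_ C⟩) (B := ⟨𝟙_ C⟩) (𝟙 (𝟙_ C))) R) (graph (λ_ B.as).hom) =
      comp (graph (λ_ A.as).hom) R :=
  Hom.ext_mem fun X a c => by
    rw [comp_graph_iso, graph_comp, mem_tensor, mem_graph]
    simp only [leftUnitor_hom, Category.assoc, leftUnitor_inv_snd, Category.comp_id]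
    exact and_iff_right (toUnit_unique _ _)

lemma rightUnitor_nat {A B : RelOver C} (R : Hom A B) :
    comp (tensor R (graph (A := ⟨𝟙_ C⟩) (B := ⟨𝟙_ C⟩) (𝟙 (𝟙_ C)))) (graph (ρ_ B.as).hom) =
      comp (graph (ρ_ A.as).hom) R :=
  Hom.ext_mem fun X a c => by
    rw [comp_graph_iso, graph_comp, mem_tensor, mem_graph]
    simp only [rightUnitor_hom, Category.assoc, rightUnitor_inv_fst, Category.comp_id]
    exact and_iff_left (toUnit_unique _ _)

/-- The graph of an isomorphism of `C`, as an isomorphism in the category of relations. -/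
noncomputable def graphIso {A B : RelOver C} (e : A.as ≅ B.as) : A ≅ B where
  hom := graph e.hom
  inv := graph e.inv
  hom_inv_id := (graph_comp_graph _ _).trans (by rw [e.hom_inv_id]; rfl)
  inv_hom_id := (graph_comp_graph _ _).trans (by rw [e.inv_hom_id]; rfl)

/-- The tensor product of relations is induced by the product of `C`; the coherence isomorphisms
are the graphs of those of `C`. -/
noncomputable instance : MonoidalCategoryStruct (RelOver C) where
  tensorObj A B := ⟨A.as ⊗ B.as⟩
  whiskerLeft A _ _ R := tensor (graph (𝟙 A.as)) R
  whiskerRight R A := tensor R (graph (𝟙 A.as))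
  tensorHom R S := tensor R S
  tensorUnit := ⟨𝟙_ C⟩
  associator A B E := graphIso (α_ A.as B.as E.as)
  leftUnitor A := graphIso (λ_ A.as)
  rightUnitor A := graphIso (ρ_ A.as)

noncomputable instance : MonoidalCategory (RelOver C) :=
  MonoidalCategory.ofTensorHom
    (id_tensorHom_id := fun A B => (tensor_graph _ _).trans (by rw [id_tensorHom_id]; rfl))
    (id_tensorHom := fun _ _ _ _ => rfl)
    (tensorHom_id := fun _ _ => rfl)
    (tensorHom_comp_tensorHom := fun R₁ R₂ S₁ S₂ => tensor_comp R₁ R₂ S₁ S₂)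
    (associator_naturality := fun R S T => associator_nat R S T)
    (leftUnitor_naturality := fun R => leftUnitor_nat R)
    (rightUnitor_naturality := fun R => rightUnitor_nat R)
    (pentagon := fun A B E F => by
      refine (congrArg₂ comp (tensor_graph _ _) (congrArg₂ comp rfl (tensor_graph _ _))).trans ?_
      refine (congrArg (comp _) (graph_comp_graph _ _)).trans ?_
      refine (graph_comp_graph _ _).trans (Eq.trans ?_ (graph_comp_graph _ _).symm)
      exact congrArg graph (by
        rw [tensorHom_id, id_tensorHom]
        exact MonoidalCategory.pentagon A.as B.as E.as F.as))
    (triangle := fun A B => by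
      refine (congrArg (comp _) (tensor_graph _ _)).trans ?_
      refine (graph_comp_graph _ _).trans (Eq.trans ?_ (tensor_graph _ _).symm)
      exact congrArg graph (by
        rw [tensorHom_id, id_tensorHom]
        exact MonoidalCategory.triangle A.as B.as))

lemma converse_graphIso {A B : RelOver C} (e : A.as ≅ B.as) :
    converse (graph e.hom) = graph e.inv :=
  Hom.ext_mem fun X b a => by rw [mem_converse, mem_graph, mem_graph, ← Iso.eq_comp_inv, eq_comm]

noncomputable instance : DaggerMonoidalCategory (RelOver C) where
  dag R := converse R
  dag_dag R := Hom.ext_mem fun X a b => by rw [mem_converse, mem_converse]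
  dag_id A := converse_graphIso (Iso.refl A.as)
  dag_comp R S := Hom.ext_mem fun X a b => by
    rw [mem_converse]
    refine (mem_comp _ _ _ _).trans (Iff.trans ?_ (mem_comp _ _ _ _).symm)
    simp only [mem_converse, and_comm]
  dag_tensor R S := Hom.ext_mem fun X a b => by
    rw [mem_converse]
    refine (mem_tensor _ _ _ _).trans (Iff.trans ?_ (mem_tensor _ _ _ _).symm)
    simp only [mem_converse]
  dag_associator A B E := converse_graphIso (α_ A.as B.as E.as)
  dag_leftUnitor A := converse_graphIso (λ_ A.as)
  dag_rightUnitor A := converse_graphIso (ρ_ A.as)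

end RelOver

/-! ### Internal categories and groupoids -/

/-- An internal category with object of objects `C₀` and object of morphisms `C₁`. The object of
composable pairs is the pullback `{(a, b) | s a = t b}` of `s` and `t`, and `m (a, b)` is the
composite `a ∘ b`. The equations are stated for generalized elements. -/
@[ext]
structure InternalCategory {C : Type u} [Category.{v} C] [HasPullbacks C] (C₀ C₁ : C) where
  /-- The source. -/
  s : C₁ ⟶ C₀
  /-- The target. -/
  t : C₁ ⟶ C₀
  /-- The identities. -/
  u : C₀ ⟶ C₁
  /-- The composition. -/
  m : pullback s t ⟶ C₁
  u_s : u ≫ s = 𝟙 C₀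
  u_t : u ≫ t = 𝟙 C₀
  m_s : m ≫ s = pullback.snd s t ≫ s
  m_t : m ≫ t = pullback.fst s t ≫ t
  id_comp {X : C} (a : X ⟶ C₁) :
    pullback.lift (a ≫ t ≫ u) a (by simp [u_s]) ≫ m = a
  comp_id {X : C} (a : X ⟶ C₁) :
    pullback.lift a (a ≫ s ≫ u) (by simp [u_t]) ≫ m = a
  assoc {X : C} (a b c : X ⟶ C₁) (hab : a ≫ s = b ≫ t) (hbc : b ≫ s = c ≫ t) :
    pullback.lift (pullback.lift a b hab ≫ m) c (by rw [Category.assoc, m_s, pullback.lift_snd_assoc, hbc]) ≫ m =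
      pullback.lift a (pullback.lift b c hbc ≫ m) (by rw [Category.assoc, m_t, pullback.lift_fst_assoc, hab]) ≫ m

/-- A pair `(f₀, f₁)` is an internal functor when it commutes with the structure. -/
structure IsInternalFunctor {C : Type u} [Category.{v} C] [HasPullbacks C] {C₀ C₁ D₀ D₁ : C}
    (G : InternalCategory C₀ C₁) (H : InternalCategory D₀ D₁) (f₀ : C₀ ⟶ D₀) (f₁ : C₁ ⟶ D₁) :
    Prop where
  map_s : G.s ≫ f₀ = f₁ ≫ H.s
  map_t : G.t ≫ f₀ = f₁ ≫ H.t
  map_u : G.u ≫ f₁ = f₀ ≫ H.u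
  map_m : G.m ≫ f₁ = pullback.map G.s G.t H.s H.t f₁ f₁ f₀ map_s map_t ≫ H.m

/-- An internal groupoid: an internal category with an inversion morphism. -/
@[ext]
structure InternalGroupoid {C : Type u} [Category.{v} C] [HasPullbacks C] (C₀ C₁ : C)
    extends InternalCategory C₀ C₁ where
  /-- The inversion. -/
  i : C₁ ⟶ C₁
  i_s : i ≫ s = t
  i_t : i ≫ t = s
  comp_inv : pullback.lift (𝟙 C₁) i (by simp [i_t]) ≫ m = t ≫ u
  inv_comp : pullback.lift i (𝟙 C₁) (by simp [i_s]) ≫ m = s ≫ u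

namespace InternalCategory

variable {C : Type u} [Category.{v} C] [CartesianMonoidalCategory C]

instance mono_u [HasPullbacks C] {C₀ C₁ : C} (G : InternalCategory C₀ C₁) :
    Mono (lift (toUnit C₀) G.u) := by
  have : Mono G.u := mono_of_mono_fac G.u_s
  exact mono_of_mono_fac (lift_snd (toUnit C₀) G.u)

instance mono_m [HasPullbacks C] {C₀ C₁ : C} (G : InternalCategory C₀ C₁) :
    Mono (lift (lift (pullback.fst G.s G.t) (pullback.snd G.s G.t)) G.m) := by
  constructor
  intro X f g h
  have h1 := congr($h ≫ fst _ _ ≫ fst _ _)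
  have h2 := congr($h ≫ fst _ _ ≫ snd _ _)
  simp at h1 h2
  exact pullback.hom_ext h1 h2

variable [Regular C] {C₀ C₁ : C} (G : InternalCategory C₀ C₁)

/-- The subobject `u : C₀ ↣ C₁` of identities, as a relation from the terminal object to `C₁`. -/
noncomputable def unitRel : 𝟙_ (RelOver C) ⟶ (⟨C₁⟩ : RelOver C) :=
  RelOver.Hom.mk (Subobject.mk (lift (toUnit C₀) G.u))

/-- The composition, as a relation from `C₁ × C₁` to `C₁`: the subobject
`{((a, b), c) | s a = t b and c = m (a, b)}`. -/
noncomputable def mulRel : (⟨C₁⟩ : RelOver C) ⊗ ⟨C₁⟩ ⟶ (⟨C₁⟩ : RelOver C) :=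
  RelOver.Hom.mk
    (Subobject.mk (lift (lift (pullback.fst G.s G.t) (pullback.snd G.s G.t)) G.m))

end InternalCategory

namespace RelOver

/-- The subobject of `A` given by a relation from the terminal object to `A`, as a morphism. -/
noncomputable def stateArrow {C : Type u} [Category.{v} C] [CartesianMonoidalCategory C]
    [Regular C] {A : RelOver C} (R : 𝟙_ (RelOver C) ⟶ A) :
    (Subobject.underlying.obj (Hom.sub R) : C) ⟶ A.as :=
  (Hom.sub R).arrow ≫ snd (𝟙_ C) A.as

end RelOver

/-! Generalized elements turn the theorem into the argument for sets. A composite of relations is an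
image, so its membership is an existential statement whose witness lives only over a strong
epimorphism (a cover) of the stage. Read this way, each Frobenius axiom is a statement about triples
with `ab = c`. From a Frobenius structure to a groupoid: speciality makes the product single-valued.
The unit laws give each `a` a left and a right unit over a cover, and associativity makes both
unique; they are its target and source. The Frobenius law, applied to `ea = a` and `af = a`, yields
an inverse of `a` (`exists_inverse`). If the right unit `e` of `a` is a left unit of `b` and `q` is
the inverse of `a`, then `(qa)b = b`, so associativity forces `ab` to be defined (`exists_mul`).
Hence the product is defined exactly on composable pairs. All these witnesses are unique, so they
descend from covers to global elements (`exists_of_local_of_unique`): a strong epimorphism here is a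
coequalizer. Applying the results to the generic element `𝟙 A` and to the universal composable pair
then produces the structure maps. Conversely, in a groupoid `ax = c` and `xd = b` are equivalent to
`cx⁻¹ = a` and `x⁻¹b = d`, which is the Frobenius law (`frobenius_aux`). Finally, the units and the
composition relation determine source, target and inversion (`rel_eq_iff`, `ext_of_mulRel_eq`). -/

namespace RelOver

/-! ### Multiplication and unit relations on generalized elements -/

variable {C : Type u} [Category.{v} C] [CartesianMonoidalCategory C]

/-- `MulMem R a b c` says that `c` is related to the pair `(a, b)` of generalized elements. -/
def MulMem {A : C} (R : Hom (⟨A ⊗ A⟩ : RelOver C) ⟨A⟩) {X : C} (a b c : X ⟶ A) : Prop :=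
  R.Mem (lift a b) c

/-- `UnitMem R e` says that the generalized element `e` belongs to the subobject of `A`
described by `R`. -/
def UnitMem {A : C} (R : Hom (⟨𝟙_ C⟩ : RelOver C) ⟨A⟩) {X : C} (e : X ⟶ A) : Prop :=
  R.Mem (toUnit X) e

lemma MulMem.precomp {A : C} {R : Hom (⟨A ⊗ A⟩ : RelOver C) ⟨A⟩} {X : C} {a b c : X ⟶ A}
    (h : MulMem R a b c) {Y : C} (p : Y ⟶ X) : MulMem R (p ≫ a) (p ≫ b) (p ≫ c) := by
  have := Hom.Mem.precomp h p
  rwa [comp_lift] at this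

lemma MulMem.descend {A : C} {R : Hom (⟨A ⊗ A⟩ : RelOver C) ⟨A⟩} {X : C} {a b c : X ⟶ A}
    {Y : C} (p : Y ⟶ X) [StrongEpi p] (h : MulMem R (p ≫ a) (p ≫ b) (p ≫ c)) :
    MulMem R a b c := by
  apply Hom.Mem.descend p
  rwa [comp_lift]

lemma UnitMem.precomp {A : C} {R : Hom (⟨𝟙_ C⟩ : RelOver C) ⟨A⟩} {X : C} {e : X ⟶ A}
    (h : UnitMem R e) {Y : C} (p : Y ⟶ X) : UnitMem R (p ≫ e) := by
  have := Hom.Mem.precomp h p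
  rwa [toUnit_unique (p ≫ toUnit X) (toUnit Y)] at this

lemma UnitMem.descend {A : C} {R : Hom (⟨𝟙_ C⟩ : RelOver C) ⟨A⟩} {X : C} {e : X ⟶ A}
    {Y : C} (p : Y ⟶ X) [StrongEpi p] (h : UnitMem R (p ≫ e)) : UnitMem R e := by
  apply Hom.Mem.descend p
  rwa [toUnit_unique (p ≫ toUnit X) (toUnit Y)]

lemma mulMem_ext {A : C} {R S : Hom (⟨A ⊗ A⟩ : RelOver C) ⟨A⟩}
    (h : ∀ (X : C) (a b c : X ⟶ A), MulMem R a b c ↔ MulMem S a b c) : R = S :=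
  Hom.ext_mem fun X a c => by
    have := h X (a ≫ fst _ _) (a ≫ snd _ _) c
    unfold MulMem at this
    rwa [← comp_lift, lift_fst_snd, Category.comp_id] at this

lemma unitMem_ext {A : C} {R S : Hom (⟨𝟙_ C⟩ : RelOver C) ⟨A⟩}
    (h : ∀ (X : C) (e : X ⟶ A), UnitMem R e ↔ UnitMem S e) : R = S :=
  Hom.ext_mem fun X a c => by
    rw [toUnit_unique a (toUnit X)]
    exact h X c

variable {A : C}

section Tensor

variable (m : Hom (⟨A ⊗ A⟩ : RelOver C) ⟨A⟩) (e : Hom (⟨𝟙_ C⟩ : RelOver C) ⟨A⟩) {X : C}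

lemma mem_iff_mulMem (a : X ⟶ A ⊗ A) (c : X ⟶ A) :
    m.Mem a c ↔ MulMem m (a ≫ fst _ _) (a ≫ snd _ _) c := by
  unfold MulMem
  rw [← comp_lift, lift_fst_snd, Category.comp_id]

lemma mem_iff_unitMem (a : X ⟶ 𝟙_ C) (x : X ⟶ A) : e.Mem a x ↔ UnitMem e x := by
  rw [toUnit_unique a (toUnit X)]
  rfl

variable [Regular C]

lemma mem_tensor_mul_id (a : X ⟶ (A ⊗ A) ⊗ A) (b : X ⟶ A ⊗ A) :
    (tensor m (graph (A := ⟨A⟩) (B := ⟨A⟩) (𝟙 A))).Mem a b ↔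
      MulMem m (a ≫ fst _ _ ≫ fst _ _) (a ≫ fst _ _ ≫ snd _ _) (b ≫ fst _ _) ∧
        b ≫ snd _ _ = a ≫ snd _ _ := by
  rw [mem_tensor, mem_graph, Category.comp_id, eq_comm (b := b ≫ snd _ _)]
  simpa using fun _ => mem_iff_mulMem m (a ≫ fst _ _) (b ≫ fst _ _)

lemma mem_tensor_id_mul (a : X ⟶ A ⊗ A ⊗ A) (b : X ⟶ A ⊗ A) :
    (tensor (graph (A := ⟨A⟩) (B := ⟨A⟩) (𝟙 A)) m).Mem a b ↔
      b ≫ fst _ _ = a ≫ fst _ _ ∧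
      MulMem m (a ≫ snd _ _ ≫ fst _ _) (a ≫ snd _ _ ≫ snd _ _) (b ≫ snd _ _) := by
  rw [mem_tensor, mem_graph, Category.comp_id, eq_comm (b := b ≫ fst _ _)]
  simpa using fun _ => mem_iff_mulMem m (a ≫ snd _ _) (b ≫ snd _ _)

lemma mem_tensor_converse_id (a : X ⟶ A ⊗ A) (b : X ⟶ (A ⊗ A) ⊗ A) :
    (tensor (converse m) (graph (A := ⟨A⟩) (B := ⟨A⟩) (𝟙 A))).Mem a b ↔
      MulMem m (b ≫ fst _ _ ≫ fst _ _) (b ≫ fst _ _ ≫ snd _ _) (a ≫ fst _ _) ∧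
        b ≫ snd _ _ = a ≫ snd _ _ := by
  rw [mem_tensor, mem_graph, mem_converse, Category.comp_id, eq_comm (b := b ≫ snd _ _)]
  simpa using fun _ => mem_iff_mulMem m (b ≫ fst _ _) (a ≫ fst _ _)

lemma mem_tensor_id_converse (a : X ⟶ A ⊗ A) (b : X ⟶ A ⊗ A ⊗ A) :
    (tensor (graph (A := ⟨A⟩) (B := ⟨A⟩) (𝟙 A)) (converse m)).Mem a b ↔
      b ≫ fst _ _ = a ≫ fst _ _ ∧
      MulMem m (b ≫ snd _ _ ≫ fst _ _) (b ≫ snd _ _ ≫ snd _ _) (a ≫ snd _ _) := by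
  rw [mem_tensor, mem_graph, mem_converse, Category.comp_id, eq_comm (b := b ≫ fst _ _)]
  simpa using fun _ => mem_iff_mulMem m (b ≫ snd _ _) (a ≫ snd _ _)

lemma mem_tensor_unit_id (a : X ⟶ 𝟙_ C ⊗ A) (b : X ⟶ A ⊗ A) :
    (tensor e (graph (A := ⟨A⟩) (B := ⟨A⟩) (𝟙 A))).Mem a b ↔
      UnitMem e (b ≫ fst _ _) ∧ b ≫ snd _ _ = a ≫ snd _ _ := by
  rw [mem_tensor, mem_graph, Category.comp_id, eq_comm (b := b ≫ snd _ _)]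
  exact and_congr_left fun _ => mem_iff_unitMem e _ _

lemma mem_tensor_id_unit (a : X ⟶ A ⊗ 𝟙_ C) (b : X ⟶ A ⊗ A) :
    (tensor (graph (A := ⟨A⟩) (B := ⟨A⟩) (𝟙 A)) e).Mem a b ↔
      b ≫ fst _ _ = a ≫ fst _ _ ∧ UnitMem e (b ≫ snd _ _) := by
  rw [mem_tensor, mem_graph, Category.comp_id, eq_comm (b := b ≫ fst _ _)]
  exact and_congr_right fun _ => mem_iff_unitMem e _ _

end Tensor

/-! ### The Frobenius axioms on generalized elements -/

variable [Regular C] (m : (⟨A⟩ : RelOver C) ⊗ ⟨A⟩ ⟶ (⟨A⟩ : RelOver C))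
  (e : 𝟙_ (RelOver C) ⟶ (⟨A⟩ : RelOver C)) {X : C}

lemma eq_id_iff (R : (⟨A⟩ : RelOver C) ⟶ ⟨A⟩) : R = 𝟙 _ ↔
    ∀ (X : C) (a c : X ⟶ A), Hom.Mem R a c ↔ a = c := by
  constructor
  · rintro rfl X a c
    exact (mem_graph _ _ _).trans (by rw [Category.comp_id])
  · intro h
    refine Hom.ext_mem fun X a c => (h X a c).trans ?_
    exact ((mem_graph _ _ _).trans (by rw [Category.comp_id])).symm

/-- Precomposing with the graph of the unitor is mere substitution, so only the remaining composite
costs a cover. -/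
lemma mem_one_mul (a c : X ⟶ A) :
    Hom.Mem ((λ_ (⟨A⟩ : RelOver C)).inv ≫ (e ▷ ⟨A⟩) ≫ m) a c ↔
      ∃ (Y : C) (p : Y ⟶ X) (_ : StrongEpi p) (x : Y ⟶ A),
        UnitMem e x ∧ MulMem m x (p ≫ a) (p ≫ c) := by
  refine (graph_comp (A := ⟨A⟩) (B := ⟨𝟙_ C ⊗ A⟩) (λ_ A).inv
    (comp (tensor e (graph (A := ⟨A⟩) (B := ⟨A⟩) (𝟙 A))) m) a c).trans ?_
  refine (mem_comp (B := ⟨A ⊗ A⟩) _ _ _ _).trans ?_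
  constructor
  · rintro ⟨Y, p, hp, b, h1, h2⟩
    obtain ⟨h1, h3⟩ := (mem_tensor_unit_id _ _ _).1 h1
    have h4 := (mem_iff_mulMem _ _ _).1 h2
    rw [h3] at h4
    exact ⟨Y, p, hp, b ≫ fst A A, h1, by simpa using h4⟩
  · rintro ⟨Y, p, hp, x, h1, h2⟩
    refine ⟨Y, p, hp, lift x (p ≫ a), (mem_tensor_unit_id _ _ _).2 ?_, h2⟩
    simpa using h1

lemma mem_mul_one (a c : X ⟶ A) :
    Hom.Mem ((ρ_ (⟨A⟩ : RelOver C)).inv ≫ (⟨A⟩ ◁ e) ≫ m) a c ↔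
      ∃ (Y : C) (p : Y ⟶ X) (_ : StrongEpi p) (x : Y ⟶ A),
        UnitMem e x ∧ MulMem m (p ≫ a) x (p ≫ c) := by
  refine (graph_comp (A := ⟨A⟩) (B := ⟨A ⊗ 𝟙_ C⟩) (ρ_ A).inv
    (comp (tensor (graph (A := ⟨A⟩) (B := ⟨A⟩) (𝟙 A)) e) m) a c).trans ?_
  refine (mem_comp (B := ⟨A ⊗ A⟩) _ _ _ _).trans ?_
  constructor
  · rintro ⟨Y, p, hp, b, h1, h2⟩
    obtain ⟨h3, h1⟩ := (mem_tensor_id_unit _ _ _).1 h1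
    have h4 := (mem_iff_mulMem _ _ _).1 h2
    rw [h3] at h4
    exact ⟨Y, p, hp, b ≫ snd A A, h1, by simpa using h4⟩
  · rintro ⟨Y, p, hp, x, h1, h2⟩
    refine ⟨Y, p, hp, lift (p ≫ a) x, (mem_tensor_id_unit _ _ _).2 ?_, h2⟩
    simpa using h1

lemma mem_assoc_left (a b c d : X ⟶ A) :
    Hom.Mem ((m ▷ ⟨A⟩) ≫ m) (lift (lift a b) c) d ↔
      ∃ (Y : C) (p : Y ⟶ X) (_ : StrongEpi p) (x : Y ⟶ A),
        MulMem m (p ≫ a) (p ≫ b) x ∧ MulMem m x (p ≫ c) (p ≫ d) := by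
  refine (mem_comp (A := ⟨(A ⊗ A) ⊗ A⟩) (B := ⟨A ⊗ A⟩)
    (tensor m (graph (A := ⟨A⟩) (B := ⟨A⟩) (𝟙 A))) m
    (lift (lift a b) c : X ⟶ (A ⊗ A) ⊗ A) d).trans ?_
  constructor
  · rintro ⟨Y, p, hp, y, h1, h2⟩
    obtain ⟨h1, h3⟩ := (mem_tensor_mul_id _ _ _).1 h1
    have h4 := (mem_iff_mulMem _ _ _).1 h2
    rw [h3] at h4
    exact ⟨Y, p, hp, y ≫ fst A A, by simpa using h1, by simpa using h4⟩
  · rintro ⟨Y, p, hp, x, h1, h2⟩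
    refine ⟨Y, p, hp, lift x (p ≫ c), (mem_tensor_mul_id _ _ _).2 ?_, h2⟩
    simpa using h1

lemma mem_assoc_right (a b c d : X ⟶ A) :
    Hom.Mem ((α_ (⟨A⟩ : RelOver C) ⟨A⟩ ⟨A⟩).hom ≫ (⟨A⟩ ◁ m) ≫ m) (lift (lift a b) c) d ↔
      ∃ (Y : C) (p : Y ⟶ X) (_ : StrongEpi p) (y : Y ⟶ A),
        MulMem m (p ≫ b) (p ≫ c) y ∧ MulMem m (p ≫ a) y (p ≫ d) := by
  refine (graph_comp (A := ⟨(A ⊗ A) ⊗ A⟩) (B := ⟨A ⊗ A ⊗ A⟩) (α_ A A A).hom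
    (comp (tensor (graph (A := ⟨A⟩) (B := ⟨A⟩) (𝟙 A)) m) m) _ d).trans ?_
  refine (mem_comp (A := ⟨A ⊗ A ⊗ A⟩) (B := ⟨A ⊗ A⟩) _ _ _ _).trans ?_
  constructor
  · rintro ⟨Y, p, hp, y, h1, h2⟩
    obtain ⟨h3, h1⟩ := (mem_tensor_id_mul _ _ _).1 h1
    have h4 := (mem_iff_mulMem _ _ _).1 h2
    rw [h3] at h4
    exact ⟨Y, p, hp, y ≫ snd A A, by simpa using h1, by simpa using h4⟩
  · rintro ⟨Y, p, hp, x, h1, h2⟩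
    refine ⟨Y, p, hp, lift (p ≫ a) x, (mem_tensor_id_mul _ _ _).2 ?_, h2⟩
    simpa using h1

lemma mem_special (c d : X ⟶ A) :
    Hom.Mem (DaggerMonoidalCategory.dag m ≫ m) c d ↔
      ∃ (Y : C) (p : Y ⟶ X) (_ : StrongEpi p) (a b : Y ⟶ A),
        MulMem m a b (p ≫ c) ∧ MulMem m a b (p ≫ d) := by
  refine (mem_comp (converse m) m c d).trans ?_
  simp only [mem_converse]
  constructor
  · rintro ⟨Y, p, hp, b, h1, h2⟩
    exact ⟨Y, p, hp, b ≫ fst A A, b ≫ snd A A, (mem_iff_mulMem _ _ _).1 h1,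
      (mem_iff_mulMem _ _ _).1 h2⟩
  · rintro ⟨Y, p, hp, a, b, h⟩
    exact ⟨Y, p, hp, lift a b, h⟩

/-- The intermediate triple is `(a, x, d)`: the converse of `m` splits `b` as `xd`, and `m` then
multiplies `a` with `x`. -/
lemma mem_frobenius_left (a b c d : X ⟶ A) :
    Hom.Mem ((⟨A⟩ ◁ DaggerMonoidalCategory.dag m) ≫ (α_ (⟨A⟩ : RelOver C) ⟨A⟩ ⟨A⟩).inv ≫
        (m ▷ ⟨A⟩)) (lift a b) (lift c d) ↔
      ∃ (Y : C) (p : Y ⟶ X) (_ : StrongEpi p) (x : Y ⟶ A),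
        MulMem m (p ≫ a) x (p ≫ c) ∧ MulMem m x (p ≫ d) (p ≫ b) := by
  refine (mem_comp (A := ⟨A ⊗ A⟩) (B := ⟨A ⊗ A ⊗ A⟩) (E := ⟨A ⊗ A⟩)
    (tensor (graph (A := ⟨A⟩) (B := ⟨A⟩) (𝟙 A)) (converse m))
    (comp (graph (A := ⟨A ⊗ A ⊗ A⟩) (B := ⟨(A ⊗ A) ⊗ A⟩) (α_ A A A).inv)
      (tensor m (graph (A := ⟨A⟩) (B := ⟨A⟩) (𝟙 A)))) _ _).trans ?_
  simp only [graph_comp]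
  constructor
  · rintro ⟨Y, p, hp, y, h1, h2⟩
    obtain ⟨h1, h3⟩ := (mem_tensor_id_converse _ _ _).1 h1
    obtain ⟨h2, h4⟩ := (mem_tensor_mul_id _ _ _).1 h2
    simp at h1 h2 h3 h4
    rw [h1] at h2
    rw [← h4] at h3
    exact ⟨Y, p, hp, _, h2, h3⟩
  · rintro ⟨Y, p, hp, x, h1, h2⟩
    refine ⟨Y, p, hp, lift (p ≫ a) (lift x (p ≫ d)), (mem_tensor_id_converse _ _ _).2 ?_,
      (mem_tensor_mul_id _ _ _).2 ?_⟩
    · simpa using h2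
    · simpa using h1

/-- Here the intermediate triple is `(c, x, b)`: `a` is split as `cx`, and `x` is then multiplied
with `b`. -/
lemma mem_frobenius_right (a b c d : X ⟶ A) :
    Hom.Mem ((DaggerMonoidalCategory.dag m ▷ ⟨A⟩) ≫ (α_ (⟨A⟩ : RelOver C) ⟨A⟩ ⟨A⟩).hom ≫
        (⟨A⟩ ◁ m)) (lift a b) (lift c d) ↔
      ∃ (Y : C) (p : Y ⟶ X) (_ : StrongEpi p) (x : Y ⟶ A),
        MulMem m (p ≫ c) x (p ≫ a) ∧ MulMem m x (p ≫ b) (p ≫ d) := by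
  refine (mem_comp (A := ⟨A ⊗ A⟩) (B := ⟨(A ⊗ A) ⊗ A⟩) (E := ⟨A ⊗ A⟩)
    (tensor (converse m) (graph (A := ⟨A⟩) (B := ⟨A⟩) (𝟙 A)))
    (comp (graph (A := ⟨(A ⊗ A) ⊗ A⟩) (B := ⟨A ⊗ A ⊗ A⟩) (α_ A A A).hom)
      (tensor (graph (A := ⟨A⟩) (B := ⟨A⟩) (𝟙 A)) m)) _ _).trans ?_
  simp only [graph_comp]
  constructor
  · rintro ⟨Y, p, hp, y, h1, h2⟩
    obtain ⟨h1, h3⟩ := (mem_tensor_converse_id _ _ _).1 h1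
    obtain ⟨h2, h4⟩ := (mem_tensor_id_mul _ _ _).1 h2
    simp at h1 h2 h3 h4
    rw [← h2] at h1
    rw [h3] at h4
    exact ⟨Y, p, hp, _, h1, h4⟩
  · rintro ⟨Y, p, hp, x, h1, h2⟩
    refine ⟨Y, p, hp, lift (lift (p ≫ c) x) (p ≫ b), (mem_tensor_converse_id _ _ _).2 ?_,
      (mem_tensor_id_mul _ _ _).2 ?_⟩
    · simpa using h1
    · simpa using h2

lemma one_mul_iff : (λ_ (⟨A⟩ : RelOver C)).inv ≫ (e ▷ ⟨A⟩) ≫ m = 𝟙 _ ↔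
    ∀ {X : C} (a c : X ⟶ A), (∃ (Y : C) (p : Y ⟶ X) (_ : StrongEpi p) (x : Y ⟶ A),
        UnitMem e x ∧ MulMem m x (p ≫ a) (p ≫ c)) ↔ a = c := by
  simp only [eq_id_iff, mem_one_mul]

lemma mul_one_iff : (ρ_ (⟨A⟩ : RelOver C)).inv ≫ (⟨A⟩ ◁ e) ≫ m = 𝟙 _ ↔
    ∀ {X : C} (a c : X ⟶ A), (∃ (Y : C) (p : Y ⟶ X) (_ : StrongEpi p) (x : Y ⟶ A),
        UnitMem e x ∧ MulMem m (p ≫ a) x (p ≫ c)) ↔ a = c := by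
  simp only [eq_id_iff, mem_mul_one]

lemma special_iff : DaggerMonoidalCategory.dag m ≫ m = 𝟙 _ ↔
    ∀ {X : C} (c d : X ⟶ A), (∃ (Y : C) (p : Y ⟶ X) (_ : StrongEpi p) (a b : Y ⟶ A),
        MulMem m a b (p ≫ c) ∧ MulMem m a b (p ≫ d)) ↔ c = d := by
  simp only [eq_id_iff, mem_special]

lemma assoc_iff :
    (m ▷ ⟨A⟩) ≫ m = (α_ (⟨A⟩ : RelOver C) ⟨A⟩ ⟨A⟩).hom ≫ (⟨A⟩ ◁ m) ≫ m ↔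
      ∀ {X : C} (a b c d : X ⟶ A),
        (∃ (Y : C) (p : Y ⟶ X) (_ : StrongEpi p) (x : Y ⟶ A),
          MulMem m (p ≫ a) (p ≫ b) x ∧ MulMem m x (p ≫ c) (p ≫ d)) ↔
        ∃ (Y : C) (p : Y ⟶ X) (_ : StrongEpi p) (y : Y ⟶ A),
          MulMem m (p ≫ b) (p ≫ c) y ∧ MulMem m (p ≫ a) y (p ≫ d) := by
  constructor
  · intro h X a b c d
    rw [← mem_assoc_left, ← mem_assoc_right, h]
  · intro h
    refine Hom.ext_mem fun X (a : X ⟶ (A ⊗ A) ⊗ A) (d : X ⟶ A) => ?_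
    have ha : a = lift (lift (a ≫ fst _ _ ≫ fst _ _) (a ≫ fst _ _ ≫ snd _ _)) (a ≫ snd _ _) := by
      ext <;> simp
    rw [ha]
    exact (mem_assoc_left m _ _ _ _).trans ((h _ _ _ _).trans (mem_assoc_right m _ _ _ _).symm)

lemma frobenius_iff :
    (⟨A⟩ ◁ DaggerMonoidalCategory.dag m) ≫ (α_ (⟨A⟩ : RelOver C) ⟨A⟩ ⟨A⟩).inv ≫ (m ▷ ⟨A⟩) =
      (DaggerMonoidalCategory.dag m ▷ ⟨A⟩) ≫ (α_ (⟨A⟩ : RelOver C) ⟨A⟩ ⟨A⟩).hom ≫ (⟨A⟩ ◁ m) ↔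
      ∀ {X : C} (a b c d : X ⟶ A),
        (∃ (Y : C) (p : Y ⟶ X) (_ : StrongEpi p) (x : Y ⟶ A),
          MulMem m (p ≫ a) x (p ≫ c) ∧ MulMem m x (p ≫ d) (p ≫ b)) ↔
        ∃ (Y : C) (p : Y ⟶ X) (_ : StrongEpi p) (x : Y ⟶ A),
          MulMem m (p ≫ c) x (p ≫ a) ∧ MulMem m x (p ≫ b) (p ≫ d) := by
  constructor
  · intro h X a b c d
    rw [← mem_frobenius_left, ← mem_frobenius_right, h]
  · intro h
    refine Hom.ext_mem fun X (a : X ⟶ A ⊗ A) (c : X ⟶ A ⊗ A) => ?_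
    have key (a : X ⟶ A ⊗ A) : a = lift (a ≫ fst _ _) (a ≫ snd _ _) := by ext <;> simp
    rw [key a, key c]
    exact (mem_frobenius_left m _ _ _ _).trans
      ((h _ _ _ _).trans (mem_frobenius_right m _ _ _ _).symm)

omit [CartesianMonoidalCategory C] in
/-- A generalized element that exists locally and is unique exists globally. -/
lemma exists_of_local_of_unique {X : C} (P : ∀ {Z : C} (_ : Z ⟶ X) (_ : Z ⟶ A), Prop)
    (precomp : ∀ {Z W : C} (r : W ⟶ Z) (q : Z ⟶ X) (x : Z ⟶ A), P q x → P (r ≫ q) (r ≫ x))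
    (unique : ∀ {Z : C} (q : Z ⟶ X) (x y : Z ⟶ A), P q x → P q y → x = y)
    {Y : C} (p : Y ⟶ X) [StrongEpi p] (x : Y ⟶ A) (hx : P p x) : ∃ z : X ⟶ A, p ≫ z = x := by
  have : IsRegularEpi p := inferInstance
  -- `p` is the coequalizer of this pair. Both restrictions of `x` satisfy `P` over the same map to
  -- `X`, so uniqueness identifies them and `x` descends.
  have h : IsRegularEpi.left p ≫ x = IsRegularEpi.right p ≫ x :=
    unique (IsRegularEpi.left p ≫ p) _ _ (precomp _ _ _ hx) (by rw [IsRegularEpi.w]; exact precomp _ _ _ hx)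
  exact ⟨IsRegularEpi.desc p x h, IsRegularEpi.fac p x h⟩

end RelOver

/-! ### The composition relation of an internal category -/

namespace InternalCategory

open RelOver

variable {C : Type u} [Category.{v} C] [CartesianMonoidalCategory C] [Regular C]
  {C₀ C₁ : C} (G : InternalCategory C₀ C₁) {X : C}

lemma mulMem_mulRel (a b c : X ⟶ C₁) :
    MulMem G.mulRel a b c ↔ ∃ h : a ≫ G.s = b ≫ G.t, pullback.lift a b h ≫ G.m = c := by
  refine (Subobject.mk_factors_iff _ _).trans ?_
  constructor
  · rintro ⟨(g : X ⟶ pullback G.s G.t),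
      (hg : g ≫ lift (lift (pullback.fst G.s G.t) (pullback.snd G.s G.t)) G.m =
        lift (lift a b) c)⟩
    have h1 := congr($hg ≫ fst _ _ ≫ fst _ _)
    have h2 := congr($hg ≫ fst _ _ ≫ snd _ _)
    have h3 := congr($hg ≫ snd _ _)
    simp at h1 h2 h3
    subst h1 h2
    refine ⟨by simp [pullback.condition], ?_⟩
    rw [← h3]
    congr 1
    apply pullback.hom_ext <;> simp [pullback.lift_fst, pullback.lift_snd]
  · rintro ⟨h, rfl⟩
    exact ⟨pullback.lift a b h, by simp [pullback.lift_fst, pullback.lift_snd]⟩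

lemma unitMem_unitRel (e : X ⟶ C₁) : UnitMem G.unitRel e ↔ ∃ x : X ⟶ C₀, x ≫ G.u = e := by
  refine (Subobject.mk_factors_iff _ _).trans ?_
  constructor
  · rintro ⟨(g : X ⟶ C₀), (hg : g ≫ lift (toUnit C₀) G.u = lift (toUnit X) e)⟩
    exact ⟨g, by simpa using congr($hg ≫ snd _ _)⟩
  · rintro ⟨x, rfl⟩
    exact ⟨x, by simp⟩

variable {G}

lemma mulMem_id_left (a : X ⟶ C₁) : MulMem G.mulRel (a ≫ G.t ≫ G.u) a a :=
  (G.mulMem_mulRel _ _ _).2 ⟨_, G.id_comp a⟩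

lemma mulMem_id_right (a : X ⟶ C₁) : MulMem G.mulRel a (a ≫ G.s ≫ G.u) a :=
  (G.mulMem_mulRel _ _ _).2 ⟨_, G.comp_id a⟩

lemma exists_mulMem {a b : X ⟶ C₁} (h : a ≫ G.s = b ≫ G.t) : ∃ c, MulMem G.mulRel a b c :=
  ⟨_, (G.mulMem_mulRel _ _ _).2 ⟨h, rfl⟩⟩

variable {a b c d x y z : X ⟶ C₁}

lemma mulMem_unique (h : MulMem G.mulRel a b c) (h' : MulMem G.mulRel a b d) : c = d := by
  obtain ⟨_, rfl⟩ := (G.mulMem_mulRel _ _ _).1 h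
  obtain ⟨_, rfl⟩ := (G.mulMem_mulRel _ _ _).1 h'
  rfl

lemma MulMem.match (h : MulMem G.mulRel a b c) : a ≫ G.s = b ≫ G.t :=
  ((G.mulMem_mulRel _ _ _).1 h).1

lemma MulMem.source (h : MulMem G.mulRel a b c) : c ≫ G.s = b ≫ G.s := by
  obtain ⟨_, rfl⟩ := (G.mulMem_mulRel _ _ _).1 h
  simp [G.m_s, pullback.lift_snd_assoc]

lemma MulMem.target (h : MulMem G.mulRel a b c) : c ≫ G.t = a ≫ G.t := by
  obtain ⟨_, rfl⟩ := (G.mulMem_mulRel _ _ _).1 h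
  simp [G.m_t, pullback.lift_fst_assoc]

/-- No cover is needed, because composites exist globally once sources and targets match; `b` and
`c` match since `x` has the source of `b`. -/
lemma mulMem_assoc (h : MulMem G.mulRel a b x) (h' : MulMem G.mulRel x c d) :
    ∃ y, MulMem G.mulRel b c y ∧ MulMem G.mulRel a y d := by
  have hbc : b ≫ G.s = c ≫ G.t := (MulMem.source h).symm.trans (MulMem.match h')
  obtain ⟨hab, rfl⟩ := (G.mulMem_mulRel _ _ _).1 h
  obtain ⟨hxc, rfl⟩ := (G.mulMem_mulRel _ _ _).1 h'
  exact ⟨_, (G.mulMem_mulRel _ _ _).2 ⟨hbc, rfl⟩,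
    (G.mulMem_mulRel _ _ _).2 ⟨_, (G.assoc a b c hab hbc).symm⟩⟩

lemma mulMem_assoc_symm (h : MulMem G.mulRel b c y) (h' : MulMem G.mulRel a y d) :
    ∃ x, MulMem G.mulRel a b x ∧ MulMem G.mulRel x c d := by
  have hab : a ≫ G.s = b ≫ G.t := (MulMem.match h').trans (MulMem.target h)
  obtain ⟨hbc, rfl⟩ := (G.mulMem_mulRel _ _ _).1 h
  obtain ⟨hay, rfl⟩ := (G.mulMem_mulRel _ _ _).1 h'
  exact ⟨_, (G.mulMem_mulRel _ _ _).2 ⟨hab, rfl⟩,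
    (G.mulMem_mulRel _ _ _).2 ⟨_, G.assoc a b c hab hbc⟩⟩

lemma eq_of_mulMem_unit_left {e : X ⟶ C₁} (he : UnitMem G.unitRel e)
    (h : MulMem G.mulRel e a c) : a = c := by
  obtain ⟨x, rfl⟩ := (G.unitMem_unitRel _).1 he
  have h1 := MulMem.match h
  rw [Category.assoc, G.u_s, Category.comp_id] at h1
  subst h1
  exact mulMem_unique (by simpa using mulMem_id_left a) h

lemma eq_of_mulMem_unit_right {e : X ⟶ C₁} (he : UnitMem G.unitRel e)
    (h : MulMem G.mulRel a e c) : a = c := by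
  obtain ⟨x, rfl⟩ := (G.unitMem_unitRel _).1 he
  have h1 := MulMem.match h
  rw [Category.assoc, G.u_t, Category.comp_id] at h1
  subst h1
  exact mulMem_unique (by simpa using mulMem_id_right a) h

lemma source_eq_of_mulMem {w : X ⟶ C₀} (h : MulMem G.mulRel a (w ≫ G.u) c) : a ≫ G.s = w := by
  simpa [G.u_t] using MulMem.match h

lemma target_eq_of_mulMem {w : X ⟶ C₀} (h : MulMem G.mulRel (w ≫ G.u) a c) : a ≫ G.t = w := by
  simpa [G.u_s] using (MulMem.match h).symm

lemma unitMem_identity (w : X ⟶ C₀) : UnitMem G.unitRel (w ≫ G.u) :=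
  (G.unitMem_unitRel _).2 ⟨w, rfl⟩

/-- A morphism between the objects of objects that preserves the identities of two internal
categories with the same composition relation is an internal functor over the identity. -/
lemma isInternalFunctor_of_mulRel_eq {C₀' : C} {G' : InternalCategory C₀' C₁} (e : C₀ ⟶ C₀')
    (he : e ≫ G'.u = G.u) (hm : G.mulRel = G'.mulRel) : IsInternalFunctor G G' e (𝟙 C₁) := by
  have hs : G.s ≫ e = 𝟙 C₁ ≫ G'.s := by
    -- The generic arrow times the identity at its source, read in `G'`, is a product with the
    -- identity at the `e`-image of that source; composability in `G'` gives the equation.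
    have h := mulMem_id_right (G := G) (𝟙 C₁)
    rw [hm, ← he, Category.id_comp, ← Category.assoc] at h
    exact (source_eq_of_mulMem h).symm
  have ht : G.t ≫ e = 𝟙 C₁ ≫ G'.t := by
    have h := mulMem_id_left (G := G) (𝟙 C₁)
    rw [hm, ← he, Category.id_comp, ← Category.assoc] at h
    exact (target_eq_of_mulMem h).symm
  refine ⟨hs, ht, by rw [he, Category.comp_id], ?_⟩
  have h : MulMem G.mulRel (pullback.fst G.s G.t) (pullback.snd G.s G.t) G.m :=
    (G.mulMem_mulRel _ _ _).2 ⟨pullback.condition, by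
      rw [← Category.id_comp G.m, ← Category.assoc]; congr 1; apply pullback.hom_ext <;> simp⟩
  rw [hm] at h
  obtain ⟨h1, h2⟩ := (G'.mulMem_mulRel _ _ _).1 h
  rw [Category.comp_id, ← h2]
  congr 1
  apply pullback.hom_ext <;> simp [pullback.lift_fst, pullback.lift_snd]

lemma mulRel_eq_of_isInternalFunctor {C₀' : C} {G' : InternalCategory C₀' C₁} (e : C₀ ⟶ C₀')
    [Mono e] (h : IsInternalFunctor G G' e (𝟙 C₁)) : G.mulRel = G'.mulRel := by
  have hs := h.map_s
  have ht := h.map_t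
  have hm := h.map_m
  rw [Category.id_comp] at hs ht
  rw [Category.comp_id] at hm
  have key {X : C} (a b : X ⟶ C₁) (h₁ : a ≫ G.s = b ≫ G.t) (h₂ : a ≫ G'.s = b ≫ G'.t) :
      pullback.lift a b h₁ ≫ G.m = pullback.lift a b h₂ ≫ G'.m := by
    rw [hm, ← Category.assoc]
    congr 1
    apply pullback.hom_ext
    · simp [pullback.map, pullback.lift_fst]
    · simp [pullback.map, pullback.lift_snd]
  refine mulMem_ext fun X a b c => ?_
  rw [mulMem_mulRel, mulMem_mulRel]
  constructor
  · rintro ⟨h₁, rfl⟩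
    have h₂ : a ≫ G'.s = b ≫ G'.t := by rw [← hs, ← ht, reassoc_of% h₁]
    exact ⟨h₂, (key a b h₁ h₂).symm⟩
  · rintro ⟨h₂, rfl⟩
    -- A pair composable in `G'` is composable in `G` because `e` is mono.
    have h₁ : a ≫ G.s = b ≫ G.t := by
      rw [← cancel_mono e, Category.assoc, Category.assoc, hs, ht, h₂]
    exact ⟨h₁, key a b h₁ h₂⟩

/-- Being an internal functor with both components identities means that all structure maps agree.
-/
lemma ext_of_mulRel_eq {G G' : InternalCategory C₀ C₁} (hu : G.u = G'.u)
    (hm : G.mulRel = G'.mulRel) : G = G' := by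
  have h := isInternalFunctor_of_mulRel_eq (𝟙 C₀) (by rw [hu, Category.id_comp]) hm
  obtain ⟨s, t, u, m, _, _, _, _, _, _, _⟩ := G
  obtain ⟨s', t', u', m', _, _, _, _, _, _, _⟩ := G'
  have hs := h.map_s
  have ht := h.map_t
  simp only [Category.comp_id, Category.id_comp] at hs ht hu
  subst hs ht hu
  have hm := h.map_m
  simp only [Category.comp_id, pullback.map_id, Category.id_comp] at hm
  subst hm
  rfl

end InternalCategory

/-! ### From groupoids to Frobenius structures -/

namespace InternalGroupoid

open RelOver InternalCategory

variable {C : Type u} [Category.{v} C] [CartesianMonoidalCategory C] [Regular C]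
  {C₀ C₁ : C} {G : InternalGroupoid C₀ C₁} {X : C}

lemma mulMem_comp_inv (a : X ⟶ C₁) : MulMem G.mulRel a (a ≫ G.i) (a ≫ G.t ≫ G.u) := by
  refine (G.mulMem_mulRel _ _ _).2 ⟨by simp [G.i_t], ?_⟩
  rw [← G.comp_inv]
  refine Eq.trans ?_ (Category.assoc _ _ _)
  congr 1
  apply pullback.hom_ext <;> simp [pullback.lift_fst, pullback.lift_snd]

lemma mulMem_inv_comp (a : X ⟶ C₁) : MulMem G.mulRel (a ≫ G.i) a (a ≫ G.s ≫ G.u) := by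
  refine (G.mulMem_mulRel _ _ _).2 ⟨by simp [G.i_s], ?_⟩
  rw [← G.inv_comp]
  refine Eq.trans ?_ (Category.assoc _ _ _)
  congr 1
  apply pullback.hom_ext <;> simp [pullback.lift_fst, pullback.lift_snd]

/-- A one-sided inverse suffices: `b = (a⁻¹a)b = a⁻¹(ab) = a⁻¹`, where `w` is the target of `a`.
This makes the inversion unique in `ext_of_mulRel_eq`. -/
lemma eq_inv_of_mulMem {a b : X ⟶ C₁} {w : X ⟶ C₀} (h : MulMem G.mulRel a b (w ≫ G.u)) :
    b = a ≫ G.i := by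
  obtain ⟨x, h1, h2⟩ := mulMem_assoc_symm h (by
    have h3 := mulMem_id_right (G := G.toInternalCategory) (a ≫ G.i)
    have h4 := MulMem.target h
    rw [Category.assoc, G.u_t, Category.comp_id] at h4
    rw [Category.assoc, reassoc_of% G.i_s, ← reassoc_of% h4] at h3
    exact h3)
  have h5 := mulMem_unique h1 (mulMem_inv_comp a)
  subst h5
  exact eq_of_mulMem_unit_left (by rw [← Category.assoc]; exact unitMem_identity _) h2

lemma ext_of_mulRel_eq {G G' : InternalGroupoid C₀ C₁} (hu : G.u = G'.u)
    (hm : G.mulRel = G'.mulRel) : G = G' := by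
  have h := InternalCategory.ext_of_mulRel_eq hu hm
  obtain ⟨G, i, h1, h2, h3, h4⟩ := G
  obtain ⟨G', i', h1', h2', h3', h4'⟩ := G'
  dsimp only at h
  subst h
  have h5 := mulMem_comp_inv (G := ⟨G, i, h1, h2, h3, h4⟩) (𝟙 C₁)
  rw [← Category.assoc] at h5
  have h6 := eq_inv_of_mulMem (G := ⟨G, i', h1', h2', h3', h4'⟩) h5
  simp only [Category.id_comp] at h6
  subst h6
  rfl

/-- Multiply by `x⁻¹` on the right and on the left. The conclusion has the form of the hypotheses
with `a, c` and `b, d` exchanged, so both directions of the Frobenius law follow from it. -/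
lemma frobenius_aux {a b c d x : X ⟶ C₁} (h1 : MulMem G.mulRel a x c)
    (h2 : MulMem G.mulRel x d b) :
    MulMem G.mulRel c (x ≫ G.i) a ∧ MulMem G.mulRel (x ≫ G.i) b d := by
  constructor
  · obtain ⟨z, hz⟩ := exists_mulMem (G := G.toInternalCategory) (a := c) (b := x ≫ G.i)
      (by rw [Category.assoc, G.i_t, MulMem.source h1])
    obtain ⟨y, h3, h4⟩ := mulMem_assoc h1 hz
    have h5 := mulMem_unique h3 (mulMem_comp_inv x)
    subst h5
    rwa [← eq_of_mulMem_unit_right (by rw [← Category.assoc]; exact unitMem_identity _) h4] at hz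
  · obtain ⟨z, hz⟩ := exists_mulMem (G := G.toInternalCategory) (a := x ≫ G.i) (b := b)
      (by rw [Category.assoc, G.i_s, MulMem.target h2])
    obtain ⟨y, h3, h4⟩ := mulMem_assoc_symm h2 hz
    have h5 := mulMem_unique h3 (mulMem_inv_comp x)
    subst h5
    rwa [← eq_of_mulMem_unit_left (by rw [← Category.assoc]; exact unitMem_identity _) h4] at hz

variable (G) in
/-- The special dagger Frobenius structure of relations given by an internal groupoid. -/
noncomputable def toFrobenius : SpecialDaggerFrobenius (⟨C₁⟩ : RelOver C) where
  mul := G.mulRel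
  one := G.unitRel
  one_mul := (one_mul_iff _ _).2 fun a c => by
    constructor
    · rintro ⟨Y, p, hp, x, h1, h2⟩
      exact (cancel_epi p).1 (eq_of_mulMem_unit_left h1 h2)
    · rintro rfl
      exact ⟨_, 𝟙 _, inferInstance, (a ≫ G.t) ≫ G.u, unitMem_identity _,
        by simpa using mulMem_id_left a⟩
  mul_one := (mul_one_iff _ _).2 fun a c => by
    constructor
    · rintro ⟨Y, p, hp, x, h1, h2⟩
      exact (cancel_epi p).1 (eq_of_mulMem_unit_right h1 h2)
    · rintro rfl
      exact ⟨_, 𝟙 _, inferInstance, (a ≫ G.s) ≫ G.u, unitMem_identity _,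
        by simpa using mulMem_id_right a⟩
  assoc := (assoc_iff _).2 fun a b c d => by
    constructor
    · rintro ⟨Y, p, hp, x, h1, h2⟩
      exact ⟨Y, p, hp, mulMem_assoc h1 h2⟩
    · rintro ⟨Y, p, hp, x, h1, h2⟩
      exact ⟨Y, p, hp, mulMem_assoc_symm h1 h2⟩
  special := (special_iff _).2 fun c d => by
    constructor
    · rintro ⟨Y, p, hp, a, b, h1, h2⟩
      exact (cancel_epi p).1 (mulMem_unique h1 h2)
    · rintro rfl
      have := mulMem_id_left (G := G.toInternalCategory) c
      exact ⟨_, 𝟙 _, inferInstance, _, _, by simpa using this, by simpa using this⟩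
  frobenius := (frobenius_iff _).2 fun a b c d => by
    constructor
    · rintro ⟨Y, p, hp, x, h1, h2⟩
      exact ⟨Y, p, hp, _, frobenius_aux h1 h2⟩
    · rintro ⟨Y, p, hp, x, h1, h2⟩
      exact ⟨Y, p, hp, _, frobenius_aux h1 h2⟩

/-- Two internal groupoids with the same object of morphisms have the same underlying relations
if and only if they are isomorphic over the identity. -/
lemma rel_eq_iff {C₀' : C} (G : InternalGroupoid C₀ C₁) (G' : InternalGroupoid C₀' C₁) :
    (G.mulRel = G'.mulRel ∧ G.unitRel = G'.unitRel) ↔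
      ∃ e : C₀ ≅ C₀',
        IsInternalFunctor G.toInternalCategory G'.toInternalCategory e.hom (𝟙 C₁) := by
  constructor
  · rintro ⟨hm, hu⟩
    -- Two monos representing the same subobject of units differ by an isomorphism of their domains;
    -- this is `e`.
    have h : Subobject.mk (lift (toUnit C₀) G.u) = Subobject.mk (lift (toUnit C₀') G'.u) :=
      congr(Hom.sub $hu)
    let e := Subobject.isoOfMkEqMk _ _ h
    have he : e.hom ≫ lift (toUnit C₀') G'.u = lift (toUnit C₀) G.u :=
      Subobject.ofMkLEMk_comp h.le
    exact ⟨e, isInternalFunctor_of_mulRel_eq e.hom (by simpa using congr($he ≫ snd _ _)) hm⟩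
  · rintro ⟨e, h⟩
    refine ⟨mulRel_eq_of_isInternalFunctor e.hom h, unitMem_ext fun X x => ?_⟩
    have hu := h.map_u
    rw [Category.comp_id] at hu
    refine (G.unitMem_unitRel x).trans (Iff.trans ?_ (G'.unitMem_unitRel x).symm)
    constructor
    · rintro ⟨w, rfl⟩
      exact ⟨w ≫ e.hom, by rw [hu, Category.assoc]⟩
    · rintro ⟨w, rfl⟩
      exact ⟨w ≫ e.inv, by rw [hu, Category.assoc, e.inv_hom_id_assoc]⟩

end InternalGroupoid

/-! ### From Frobenius structures to groupoids -/

namespace SpecialDaggerFrobenius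

open RelOver

variable {C : Type u} [Category.{v} C] [CartesianMonoidalCategory C] [Regular C]
  {A : C} {F : SpecialDaggerFrobenius (⟨A⟩ : RelOver C)} {X : C} {a b c d e f x y : X ⟶ A}

/-- Two products of one pair are related by the composite of the converse of `F.mul` with `F.mul`,
which speciality makes the identity. -/
lemma mulMem_unique (h : MulMem F.mul a b c) (h' : MulMem F.mul a b d) : c = d :=
  ((special_iff _).1 F.special c d).1
    ⟨X, 𝟙 X, inferInstance, a, b, by simpa using h, by simpa using h'⟩

lemma eq_of_unit_left (he : UnitMem F.one e) (h : MulMem F.mul e a c) : a = c :=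
  ((one_mul_iff _ _).1 F.one_mul a c).1 ⟨X, 𝟙 X, inferInstance, e, he, by simpa using h⟩

lemma eq_of_unit_right (he : UnitMem F.one e) (h : MulMem F.mul a e c) : a = c :=
  ((mul_one_iff _ _).1 F.mul_one a c).1 ⟨X, 𝟙 X, inferInstance, e, he, by simpa using h⟩

lemma mulMem_assoc (h : MulMem F.mul a b x) (h' : MulMem F.mul x c d) :
    ∃ (Y : C) (p : Y ⟶ X) (_ : StrongEpi p) (y : Y ⟶ A),
      MulMem F.mul (p ≫ b) (p ≫ c) y ∧ MulMem F.mul (p ≫ a) y (p ≫ d) :=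
  ((assoc_iff _).1 F.assoc a b c d).1
    ⟨X, 𝟙 X, inferInstance, x, by simpa using h, by simpa using h'⟩

lemma mulMem_assoc_symm (h : MulMem F.mul b c y) (h' : MulMem F.mul a y d) :
    ∃ (Y : C) (p : Y ⟶ X) (_ : StrongEpi p) (x : Y ⟶ A),
      MulMem F.mul (p ≫ a) (p ≫ b) x ∧ MulMem F.mul x (p ≫ c) (p ≫ d) :=
  ((assoc_iff _).1 F.assoc a b c d).2
    ⟨X, 𝟙 X, inferInstance, y, by simpa using h, by simpa using h'⟩

/-- From `e(fa) = a`, associativity makes `ef` defined over a cover. As both factors are units, `ef`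
equals `e` and also `f`. -/
lemma eq_of_left_units (he : UnitMem F.one e) (hf : UnitMem F.one f) (h : MulMem F.mul e a a)
    (h' : MulMem F.mul f a a) : e = f := by
  obtain ⟨Y, p, _, x, h1, -⟩ := mulMem_assoc_symm h' h
  rw [← cancel_epi p, eq_of_unit_right (hf.precomp p) h1, eq_of_unit_left (he.precomp p) h1]

lemma eq_of_right_units (he : UnitMem F.one e) (hf : UnitMem F.one f) (h : MulMem F.mul a e a)
    (h' : MulMem F.mul a f a) : e = f := by
  obtain ⟨Y, p, _, x, h1, -⟩ := mulMem_assoc h h'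
  rw [← cancel_epi p, eq_of_unit_right (hf.precomp p) h1, eq_of_unit_left (he.precomp p) h1]

/-- The unit law provides `e` over a cover, and `eq_of_left_units` makes it descend. -/
lemma exists_left_unit (F : SpecialDaggerFrobenius (⟨A⟩ : RelOver C)) (a : X ⟶ A) :
    ∃ e, UnitMem F.one e ∧ MulMem F.mul e a a := by
  obtain ⟨Y, p, _, x, hx⟩ := ((one_mul_iff _ _).1 F.one_mul a a).2 rfl
  obtain ⟨e, rfl⟩ := exists_of_local_of_unique
    (fun q x => UnitMem F.one x ∧ MulMem F.mul x (q ≫ a) (q ≫ a))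
    (fun r q x h => ⟨h.1.precomp r, by simpa using h.2.precomp r⟩)
    (fun q x y h h' => eq_of_left_units h.1 h'.1 h.2 h'.2) p x hx
  exact ⟨e, hx.1.descend p, hx.2.descend p⟩

lemma exists_right_unit (F : SpecialDaggerFrobenius (⟨A⟩ : RelOver C)) (a : X ⟶ A) :
    ∃ e, UnitMem F.one e ∧ MulMem F.mul a e a := by
  obtain ⟨Y, p, _, x, hx⟩ := ((mul_one_iff _ _).1 F.mul_one a a).2 rfl
  obtain ⟨e, rfl⟩ := exists_of_local_of_unique
    (fun q x => UnitMem F.one x ∧ MulMem F.mul (q ≫ a) x (q ≫ a))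
    (fun r q x h => ⟨h.1.precomp r, by simpa using h.2.precomp r⟩)
    (fun q x y h h' => eq_of_right_units h.1 h'.1 h.2 h'.2) p x hx
  exact ⟨e, hx.1.descend p, hx.2.descend p⟩

lemma mulMem_unit_self (he : UnitMem F.one e) : MulMem F.mul e e e := by
  obtain ⟨f, -, h⟩ := F.exists_left_unit e
  obtain rfl := eq_of_unit_right he h
  exact h

/-- The right unit of the first factor of a product is a left unit of the second factor. -/
lemma mulMem_of_right_unit (h : MulMem F.mul a b c) (he : UnitMem F.one e)
    (hae : MulMem F.mul a e a) : MulMem F.mul e b b := by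
  obtain ⟨Y, p, _, y, h1, -⟩ := mulMem_assoc hae h
  obtain rfl := eq_of_unit_left (he.precomp p) h1
  exact h1.descend p

lemma left_unit_mul (h : MulMem F.mul a b c) (hea : MulMem F.mul e a a) :
    MulMem F.mul e c c := by
  obtain ⟨Y, p, _, y, h1, h2⟩ := mulMem_assoc hea h
  obtain rfl := mulMem_unique h1 (h.precomp p)
  exact h2.descend p

lemma right_unit_mul (h : MulMem F.mul a b c) (hbe : MulMem F.mul b e b) :
    MulMem F.mul c e c := by
  obtain ⟨Y, p, _, y, h1, h2⟩ := mulMem_assoc_symm hbe h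
  obtain rfl := mulMem_unique h1 (h.precomp p)
  exact h2.descend p

/-- `y = fy = (xa)y = x(ay) = xe = x`. -/
lemma eq_of_inverses (he : UnitMem F.one e) (hf : UnitMem F.one f) (haf : MulMem F.mul a f a)
    (hx : MulMem F.mul x a f) (hy : MulMem F.mul a y e) : x = y := by
  obtain ⟨Y, p, _, z, h1, h2⟩ := mulMem_assoc hx (mulMem_of_right_unit hy hf haf)
  obtain rfl := mulMem_unique h1 (hy.precomp p)
  exact (cancel_epi p).1 (eq_of_unit_right (he.precomp p) h2)

lemma exists_inverse (he : UnitMem F.one e) (hf : UnitMem F.one f) (hea : MulMem F.mul e a a)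
    (haf : MulMem F.mul a f a) : ∃ x, MulMem F.mul a x e ∧ MulMem F.mul x a f := by
  -- With the middle element `a`, the equations `ea = a` and `af = a` form one side of the Frobenius
  -- law; the other side gives `x` with `ax = e` and `xa = f`.
  obtain ⟨Y, p, _, x, hx⟩ := ((frobenius_iff _).1 F.frobenius e a a f).1
    ⟨X, 𝟙 X, inferInstance, a, by simpa using hea, by simpa using haf⟩
  obtain ⟨z, rfl⟩ := exists_of_local_of_unique
    (fun q x => MulMem F.mul (q ≫ a) x (q ≫ e) ∧ MulMem F.mul x (q ≫ a) (q ≫ f))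
    (fun r q x h => ⟨by simpa using h.1.precomp r, by simpa using h.2.precomp r⟩)
    (fun q x y h h' => eq_of_inverses (he.precomp q) (hf.precomp q) (haf.precomp q) h.2 h'.1)
    p x hx
  exact ⟨z, hx.1.descend p, hx.2.descend p⟩

/-- With `q` the inverse of `a`, the product `(qa)b = eb` is defined, so associativity makes `ab`
defined over a cover; single-valuedness makes it descend. -/
lemma exists_mul (he : UnitMem F.one e) (ha : MulMem F.mul a e a) (hb : MulMem F.mul e b b) :
    ∃ c, MulMem F.mul a b c := by
  obtain ⟨f, hf, hfa⟩ := F.exists_left_unit a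
  obtain ⟨q, -, hq⟩ := exists_inverse hf he hfa ha
  obtain ⟨Y, p, _, y, hy, -⟩ := mulMem_assoc hq hb
  obtain ⟨z, rfl⟩ := exists_of_local_of_unique (fun q x => MulMem F.mul (q ≫ a) (q ≫ b) x)
    (fun r q x h => by simpa using h.precomp r) (fun q x y h h' => mulMem_unique h h') p y hy
  exact ⟨z, hy.descend p⟩

lemma unitMem_iff (F : SpecialDaggerFrobenius (⟨A⟩ : RelOver C)) (e : X ⟶ A) :
    UnitMem F.one e ↔ ∃ x, x ≫ stateArrow F.one = e := by
  constructor
  · intro h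
    exact ⟨(Hom.sub F.one).factorThru _ h,
      (Subobject.factorThru_arrow_assoc _ _ _ _).trans (lift_snd _ _)⟩
  · rintro ⟨x, rfl⟩
    have h : lift (toUnit X) (x ≫ stateArrow F.one) = x ≫ (Hom.sub F.one).arrow := by
      apply CartesianMonoidalCategory.hom_ext
      · exact toUnit_unique _ _
      · exact (lift_snd _ _).trans (Category.assoc _ _ _).symm
    exact (congrArg (Hom.sub F.one).Factors h).mpr (Subobject.factors_comp_arrow x)

instance mono_stateArrow (F : SpecialDaggerFrobenius (⟨A⟩ : RelOver C)) :
    Mono (stateArrow F.one) where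
  right_cancellation g h w := by
    rw [← cancel_mono (Hom.sub F.one).arrow]
    apply CartesianMonoidalCategory.hom_ext
    · exact toUnit_unique _ _
    · exact (Category.assoc _ _ _).trans (w.trans (Category.assoc _ _ _).symm)

/-- The internal groupoid given by a special dagger Frobenius structure of relations. -/
lemma exists_groupoid (F : SpecialDaggerFrobenius (⟨A⟩ : RelOver C)) :
    ∃ G : InternalGroupoid (Subobject.underlying.obj (RelOver.Hom.sub F.one)) A,
      G.u = stateArrow F.one ∧ G.mulRel = F.mul := by
  set ι := stateArrow F.one with hι
  have unit {X : C} (x : X ⟶ _) : UnitMem F.one (x ≫ ι) := (F.unitMem_iff _).2 ⟨x, rfl⟩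
  -- The left unit, right unit and inverse of the generic element are the target, source and
  -- inversion maps.
  obtain ⟨t', ht', ht⟩ := F.exists_left_unit (𝟙 A)
  obtain ⟨t, rfl⟩ := (F.unitMem_iff _).1 ht'
  obtain ⟨s', hs', hs⟩ := F.exists_right_unit (𝟙 A)
  obtain ⟨s, rfl⟩ := (F.unitMem_iff _).1 hs'
  obtain ⟨i, hi, hi'⟩ := exists_inverse ht' hs' ht hs
  simp only [← hι] at *
  have ht {X : C} (a : X ⟶ A) : MulMem F.mul ((a ≫ t) ≫ ι) a a := by
    simpa using ht.precomp a
  have hs {X : C} (a : X ⟶ A) : MulMem F.mul a ((a ≫ s) ≫ ι) a := by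
    simpa using hs.precomp a
  have t_eq {X : C} {x : X ⟶ _} {a : X ⟶ A} (h : MulMem F.mul (x ≫ ι) a a) : a ≫ t = x := by
    rw [← cancel_mono ι]
    exact eq_of_left_units (unit _) (unit _) (ht a) h
  have s_eq {X : C} {x : X ⟶ _} {a : X ⟶ A} (h : MulMem F.mul a (x ≫ ι) a) : a ≫ s = x := by
    rw [← cancel_mono ι]
    exact eq_of_right_units (unit _) (unit _) (hs a) h
  have hst {X : C} {a b c : X ⟶ A} (h : MulMem F.mul a b c) : a ≫ s = b ≫ t :=
    (t_eq (mulMem_of_right_unit h (unit _) (hs a))).symm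
  have hcs {X : C} {a b c : X ⟶ A} (h : MulMem F.mul a b c) : c ≫ s = b ≫ s :=
    s_eq (right_unit_mul h (hs b))
  have hct {X : C} {a b c : X ⟶ A} (h : MulMem F.mul a b c) : c ≫ t = a ≫ t :=
    t_eq (left_unit_mul h (ht a))
  have ι_self : MulMem F.mul ι ι ι := mulMem_unit_self (by simpa using unit (𝟙 _))
  have hιs : ι ≫ s = 𝟙 _ := s_eq (by simpa using ι_self)
  have hιt : ι ≫ t = 𝟙 _ := t_eq (by simpa using ι_self)
  -- `m` is the product of the universal composable pair, of which every composable pair is a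
  -- restriction.
  obtain ⟨m, hm⟩ := exists_mul (F := F) (unit (pullback.fst s t ≫ s)) (hs _)
    (by rw [pullback.condition]; exact ht _)
  have hm' {X : C} (a b : X ⟶ A) (h : a ≫ s = b ≫ t) :
      MulMem F.mul a b (pullback.lift a b h ≫ m) := by
    simpa only [pullback.lift_fst, pullback.lift_snd] using hm.precomp (pullback.lift a b h)
  have his : i ≫ s = t := by
    have := hcs hi
    rw [← this, Category.assoc, hιs, Category.comp_id]
  have hit : i ≫ t = s := by
    have := hct hi'
    rw [← this, Category.assoc, hιt, Category.comp_id]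
  refine ⟨{ s := s, t := t, u := ι, m := m, i := i, u_s := hιs, u_t := hιt,
            m_s := hcs hm, m_t := hct hm, i_s := his, i_t := hit,
            id_comp := fun a => ?_, comp_id := fun a => ?_, assoc := fun a b c hab hbc => ?_,
            comp_inv := ?_, inv_comp := ?_ }, rfl, ?_⟩
  · exact mulMem_unique (hm' _ _ _) (by simpa using ht a)
  · exact mulMem_unique (hm' _ _ _) (by simpa using hs a)
  -- The two bracketings agree after restriction to the cover `p`, which is epi.
  · obtain ⟨Y, p, _, y, h1, h2⟩ := mulMem_assoc (hm' a b hab)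
      (hm' (pullback.lift a b hab ≫ m) c ((hcs (hm' a b hab)).trans hbc))
    obtain rfl := mulMem_unique h1 ((hm' b c hbc).precomp p)
    exact (cancel_epi p).1 (mulMem_unique h2 ((hm' _ _ _).precomp p))
  · exact mulMem_unique (hm' _ _ _) hi
  · exact mulMem_unique (hm' _ _ _) hi'
  · refine mulMem_ext fun X a b c => (InternalCategory.mulMem_mulRel _ _ _ _).trans ?_
    constructor
    · rintro ⟨h, rfl⟩
      exact hm' a b h
    · intro h
      exact ⟨hst h, mulMem_unique (hm' a b (hst h)) h⟩

end SpecialDaggerFrobenius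

theorem mainTheorem2 {C : Type u} [Category.{v} C] [CartesianMonoidalCategory C] [Regular C] :
    -- a Frobenius structure in relations is an internal groupoid, in exactly one way
    (∀ (A : C) (F : SpecialDaggerFrobenius (⟨A⟩ : RelOver C)),
      ∃! G : InternalGroupoid (Subobject.underlying.obj (RelOver.Hom.sub F.one)) A,
        G.u = RelOver.stateArrow F.one ∧ G.mulRel = F.mul) ∧
    -- conversely, an internal groupoid gives a Frobenius structure on its object of morphisms
    (∀ (C₀ C₁ : C) (G : InternalGroupoid C₀ C₁),
      ∃ F : SpecialDaggerFrobenius (⟨C₁⟩ : RelOver C), F.mul = G.mulRel ∧ F.one = G.unitRel) ∧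
    -- two internal groupoids give the same Frobenius structure precisely when they are
    -- isomorphic over the identity of the object of morphisms
    (∀ (C₀ C₀' A : C) (G : InternalGroupoid C₀ A) (G' : InternalGroupoid C₀' A),
      (G.mulRel = G'.mulRel ∧ G.unitRel = G'.unitRel) ↔
        ∃ e : C₀ ≅ C₀',
          IsInternalFunctor G.toInternalCategory G'.toInternalCategory e.hom (𝟙 A)) := by
  refine ⟨fun A F => ?_, fun C₀ C₁ G => ⟨G.toFrobenius, rfl, rfl⟩,
    fun C₀ C₀' A G G' => InternalGroupoid.rel_eq_iff G G'⟩
  obtain ⟨G, hu, hm⟩ := F.exists_groupoid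
  exact ⟨G, ⟨hu, hm⟩, fun G' h =>
    InternalGroupoid.ext_of_mulRel_eq (h.1.trans hu.symm) (h.2.trans hm.symm)⟩
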